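/- \textbf{Setting.} Let $N$ be the number of decision makers. Let $\Omega_0$ be a topological space with its Borel $\sigma$-algebra. For $k=1,\dots,N$ let $\mathbb{Y}^k$ (measurements) be a separable metric space with metric $d_k$, and let $\mathbb{U}^k$ (actions) be a nonempty separable metrizable space, each with its Borel $\sigma$-algebra. Let $\mu$ be a probability measure on $\Omega_0\times\prod_k\mathbb{Y}^k$, and let $c:\Omega_0\times\prod_k\mathbb{Y}^k\times\prod_k\mathbb{U}^k\to[0,\infty)$ be measurable. Let $\Gamma^k$ be the set of measurable maps $\mathbb{Y}^k\to\mathbb{U}^k$ and $\mathbf{\Gamma}=\prod_k\Gamma^k$. For $\underline{\gamma}\in\mathbf{\Gamma}$ put $J(\underline{\gamma})=\int c(\omega_0,\mathbf{y},\gamma^1(y^1),\dots,\gamma^N(y^N))\,\mu(d\omega_0,d\mathbf{y})\in[0,\infty]$, and let $J^*=\inf_{\underline{\gamma}\in\mathbf{\Gamma}}J(\underline{\gamma})$. The strategic measure induced by $\underline{\gamma}$ is the probability measure $P$ on $\Omega_0\times\prod_k(\mathbb{Y}^k\times\mathbb{U}^k)$ with $$P\Big(B^0\times\prod_k(A^k\times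 B^k)\Big)=\int_{B^0\times\prod_kA^k}\prod_k1_{\{\gamma^k(y^k)\in B^k\}}\,\mu(d\omega_0,d\mathbf{y})$$ for all measurable $B^0,A^k,B^k$; write $\int P(ds)\,c(s)$ for the integral of $c$ under $P$. For $G\subset\prod_k\mathbb{U}^k$ let $\mathbf{\Gamma}_G$ be the set of $\underline{\gamma}\in\mathbf{\Gamma}$ with $\underline{\gamma}(\prod_k\mathbb{Y}^k)\subset G$. Let $L_A^G(\mu)$ be the set of strategic measures induced by policies in $\mathbf{\Gamma}_G$, and $L_A^{G,c}(\mu)$ the set of those induced by policies in $\mathbf{\Gamma}_G$ all of whose components are continuous. \textbf{Quantizers.} For each $i$ fix compact sets $K^i_l\subset\mathbb{Y}^i$ $(l\ge1)$ with $K^i_l\subset\operatorname{int}K^i_{l+1}$ and $\bigcup_lK^i_l=\mathbb{Y}^i$; for $l,n\ge1$ a finite set $\mathbb{Y}^i_{l,n}\subset K^i_l$ such that every $y\in K^i_l$ satisfies $d_i(y,z)<1/n$ for some $z\in\mathbb{Y}^i_{l,n}$; a point $y_{i,0}\in\mathbb{Y}^i$; and a measurable map $Q^i_{l,n}:\mathbb{Y}^i\to\mathbb{Y}^i$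 that sends each $y\in K^i_l$ to a point of $\mathbb{Y}^i_{l,n}$ nearest to $y$ and each $y\notin K^i_l$ to $y_{i,0}$. Let $L_A^{l,n}(\mu)$ be the set of strategic measures induced by policies of the form $(\gamma^1\circ Q^1_{l,n},\dots,\gamma^N\circ Q^N_{l,n})$ with $\underline{\gamma}\in\mathbf{\Gamma}$. \textbf{Assumptions.} (a) For every $\omega_0$, $c(\omega_0,\cdot,\cdot)$ is continuous in $(\mathbf{y},\mathbf{u})$, and $c$ is bounded on every compact subset of $\Omega_0\times\prod_k(\mathbb{Y}^k\times\mathbb{U}^k)$. (b) Each $\mathbb{U}^k$ is a closed convex subset of a completely metrizable locally convex real vector space. (c) Each $\mathbb{Y}^k$ is locally compact. (d) For every $G=\prod_kG^k$ with each $G^k\subset\mathbb{U}^k$ compact, $w_G(\omega_0,\mathbf{y})=\sup_{\mathbf{u}\in G}c(\omega_0,\mathbf{y},\mathbf{u})$ is $\mu$-integrable. (e) For every $\underline{\gamma}\in\mathbf{\Gamma}$ with $J(\underline{\gamma})<\infty$ and every $k$ there is $u\in\mathbb{U}^k$ such that replacing $\gamma^k$ in $\underline{\gamma}$ by the constant policy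 $u$ gives a policy of finite cost. \textbf{Claim.} Under (a)--(e), the following hold. (1) For every $\varepsilon>0$ there is $G=\prod_{i=1}^NG^i$, with each $G^i\subset\mathbb{U}^i$ convex and compact, such that $$\inf_{P\in L_A^{G,c}(\mu)}\int P(ds)\,c(s)<J^*+\varepsilon .$$ (2) For every $\varepsilon>0$ there are $l,n\ge1$, a set $G=\prod_{i=1}^NG^i$ with each $G^i\subset\mathbb{U}^i$ convex and compact, and $P\in L_A^{l,n}(\mu)\cap L_A^G(\mu)$ such that $$\int P(ds)\,c(s)<J^*+\varepsilon .$$ -/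

import Mathlib

open MeasureTheory Set
open scoped ENNReal NNReal

namespace StaticTeam

section Model

variable {N : ℕ} {Ω₀ : Type*} {Y U : Fin N → Type*}

/-- The action profile `u = (γ¹(y¹), …, γᴺ(yᴺ))`. -/
def action (γ : ∀ k, Y k → U k) (y : ∀ k, Y k) : ∀ k, U k := fun k => γ k (y k)

/-- The worst-case cost `w_G(ω₀, y) = sup_{u ∈ G} c(ω₀, y, u)`. -/
noncomputable def worstCost (c : Ω₀ → (∀ k, Y k) → (∀ k, U k) → ℝ≥0) (G : Set (∀ k, U k))
    (s : Ω₀ × (∀ k, Y k)) : ℝ≥0∞ :=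
  ⨆ u ∈ G, (c s.1 s.2 u : ℝ≥0∞)

variable [MeasurableSpace Ω₀] [∀ k, MeasurableSpace (Y k)] [∀ k, MeasurableSpace (U k)]

/-- The admissible team policies `Γ = ∏ Γᵏ`: each `γᵏ : Yᵏ → Uᵏ` is measurable. -/
def policies (Y U : Fin N → Type*) [∀ k, MeasurableSpace (Y k)] [∀ k, MeasurableSpace (U k)] :
    Set (∀ k, Y k → U k) :=
  {γ | ∀ k, Measurable (γ k)}

/-- `Γ_G`: the admissible policies with `γ(∏ Yᵏ) ⊆ G`. -/
def policiesInto (Y : Fin N → Type*) [∀ k, MeasurableSpace (Y k)] (G : Set (∀ k, U k)) :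
    Set (∀ k, Y k → U k) :=
  {γ | γ ∈ policies Y U ∧ ∀ y, action γ y ∈ G}

/-- `Γ_c`: the admissible policies with every `γᵏ` continuous. -/
def continuousPolicies (Y U : Fin N → Type*) [∀ k, MeasurableSpace (Y k)]
    [∀ k, MeasurableSpace (U k)] [∀ k, TopologicalSpace (Y k)] [∀ k, TopologicalSpace (U k)] :
    Set (∀ k, Y k → U k) :=
  {γ | γ ∈ policies Y U ∧ ∀ k, Continuous (γ k)}

/-- The policies of the form `(γ¹ ∘ Q¹, …, γᴺ ∘ Qᴺ)` with `γ` admissible. -/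
def policiesThrough (U : Fin N → Type*) [∀ k, MeasurableSpace (U k)] (Q : ∀ k, Y k → Y k) :
    Set (∀ k, Y k → U k) :=
  {γ' | γ' ∈ policies Y U ∧ ∃ γ ∈ policies Y U, ∀ k, γ' k = γ k ∘ Q k}

/-- The expected cost `J(γ) = E[c(ω₀, y, γ(y))]`, `(ω₀, y) ∼ μ`. -/
noncomputable def cost (c : Ω₀ → (∀ k, Y k) → (∀ k, U k) → ℝ≥0) (μ : Measure (Ω₀ × (∀ k, Y k)))
    (γ : ∀ k, Y k → U k) : ℝ≥0∞ :=
  ∫⁻ s, (c s.1 s.2 (action γ s.2) : ℝ≥0∞) ∂μ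

/-- The optimal team cost `J* = inf_{γ ∈ Γ} J(γ)`. -/
noncomputable def optimalCost (c : Ω₀ → (∀ k, Y k) → (∀ k, U k) → ℝ≥0)
    (μ : Measure (Ω₀ × (∀ k, Y k))) : ℝ≥0∞ :=
  ⨅ γ ∈ policies Y U, cost c μ γ

/-- `P` is the strategic measure of the policy `γ`: on every measurable cylinder,
`P(B⁰ × ∏ (Aᵏ × Bᵏ)) = ∫_{B⁰ × ∏ Aᵏ} ∏ 1{γᵏ(yᵏ) ∈ Bᵏ} dμ`. -/
def IsInducedBy (μ : Measure (Ω₀ × (∀ k, Y k))) (γ : ∀ k, Y k → U k)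
    (P : ProbabilityMeasure (Ω₀ × (∀ k, Y k × U k))) : Prop :=
  ∀ (B₀ : Set Ω₀) (A : ∀ k, Set (Y k)) (B : ∀ k, Set (U k)),
    MeasurableSet B₀ → (∀ k, MeasurableSet (A k)) → (∀ k, MeasurableSet (B k)) →
    (P : Measure (Ω₀ × (∀ k, Y k × U k))) (B₀ ×ˢ univ.pi fun k => A k ×ˢ B k) =
      ∫⁻ s in B₀ ×ˢ univ.pi A, ∏ k, (B k).indicator (fun _ => (1 : ℝ≥0∞)) (γ k (s.2 k)) ∂μ

/-- The strategic measures induced by the policies in a set `S` of policies.  For `S = Γ` this is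
`L_A(μ)`, for `S = Γ_G` it is `L_A^G(μ)`, and so on. -/
def strategicMeasures (μ : Measure (Ω₀ × (∀ k, Y k))) (S : Set (∀ k, Y k → U k)) :
    Set (ProbabilityMeasure (Ω₀ × (∀ k, Y k × U k))) :=
  {P | ∃ γ ∈ S, IsInducedBy μ γ P}

/-- `∫ P(ds) c(s)`. -/
noncomputable def measureCost (c : Ω₀ → (∀ k, Y k) → (∀ k, U k) → ℝ≥0)
    (P : ProbabilityMeasure (Ω₀ × (∀ k, Y k × U k))) : ℝ≥0∞ :=
  ∫⁻ s, (c s.1 (fun k => (s.2 k).1) (fun k => (s.2 k).2) : ℝ≥0∞)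
    ∂(P : Measure (Ω₀ × (∀ k, Y k × U k)))

end Model

/-- A family of measurement quantizers `Q_{l,n}`, `l, n ≥ 1`, on a metric space: an exhaustion
`K_1 ⊆ int K_2 ⊆ K_2 ⊆ ⋯` by compact sets, a finite `1/n`-net in each `K_l`, and for each `(l, n)` a
measurable map that sends a point of `K_l` to a nearest point of the net and every point outside
`K_l` to the auxiliary point `y₀`. (Values at `l = 0` or `n = 0` play no role.) -/
structure QuantizerFamily (Y : Type*) [MetricSpace Y] [MeasurableSpace Y] where
  K : ℕ → Set Y
  net : ℕ → ℕ → Finset Y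
  y₀ : Y
  Q : ℕ → ℕ → Y → Y
  isCompact_K : ∀ l, 1 ≤ l → IsCompact (K l)
  K_subset : ∀ l, 1 ≤ l → K l ⊆ interior (K (l + 1))
  exhausts : ∀ y, ∃ l, 1 ≤ l ∧ y ∈ K l
  net_subset : ∀ l n, 1 ≤ l → 1 ≤ n → (net l n : Set Y) ⊆ K l
  isNet : ∀ l n, 1 ≤ l → 1 ≤ n → ∀ y ∈ K l, ∃ z ∈ net l n, dist y z < 1 / (n : ℝ)
  Q_mem : ∀ l n, 1 ≤ l → 1 ≤ n → ∀ y ∈ K l, Q l n y ∈ net l n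
  Q_nearest : ∀ l n, 1 ≤ l → 1 ≤ n → ∀ y ∈ K l, ∀ z ∈ net l n, dist y (Q l n y) ≤ dist y z
  Q_outside : ∀ l n, 1 ≤ l → 1 ≤ n → ∀ y ∉ K l, Q l n y = y₀
  measurable_Q : ∀ l n, 1 ≤ l → 1 ≤ n → Measurable (Q l n)

end StaticTeam

/-!
Everything reduces to dominated convergence of the cost `J`: if admissible policies with values in
a compact product `G` converge almost surely, then their costs converge, because `c` is continuous
in the actions and `w_G` is integrable (`StaticTeam.tendsto_cost`).

Since constant policies have finite cost, `J*` is finite and there is an admissible policy of cost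
below `J* + ε`. Its components are cut off one at a time outside a compact set, on which the law
of the action is concentrated by tightness on Polish spaces; the values outside are replaced by a
constant for which the cost remains finite, so that absolute continuity of the integral bounds the
increase of the cost (`StaticTeam.exists_policy_mem_compact`). The resulting compact-valued policy
is the pointwise limit of simple ones with values in the same compact sets. A simple policy takes
values in the convex hull `G` of finitely many actions, which is compact; it is the composition of a
bounded integer-valued measurable index with a continuous path in `G` through its values, and
approximating the index almost surely by continuous functions gives continuous policies with
values in `G` (`StaticTeam.exists_continuous_policy`). This yields the first claim.

For the second claim, the quantizers `Q_{n,n}` converge pointwise to the identity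
(`StaticTeam.QuantizerFamily.tendsto_Q`), so composing a continuous near-optimal policy with them
gives policies with values in `G` whose costs converge to its cost.
-/

open Filter Topology

/-! ### Paths and continuous approximation -/

/-- In a convex set any finite list of points is joined by a continuous polygonal path that is
parametrized by the whole real line and visits `u j` at time `j`. -/
theorem Convex.exists_continuous_path {E : Type*} [AddCommGroup E] [Module ℝ E]
    [TopologicalSpace E] [IsTopologicalAddGroup E] [ContinuousSMul ℝ E] {G : Set E}
    (hG : Convex ℝ G) (u : ℕ → E) (hu : ∀ j, u j ∈ G) (m : ℕ) :
    ∃ p : ℝ → E, Continuous p ∧ (∀ t, p t ∈ G) ∧ ∀ j ≤ m, p j = u j := by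
  induction m with
  | zero => exact ⟨fun _ => u 0, continuous_const, fun _ => hu 0, by simp⟩
  | succ m ih =>
    obtain ⟨p, hp, hpG, hpu⟩ := ih
    refine ⟨fun t => p (min t m) + (max 0 (min (t - m) 1)) • (u (m + 1) - u m),
      by fun_prop, fun t => ?_, fun j hj => ?_⟩
    · rcases le_total t m with ht | ht
      · have : max 0 (min (t - m) 1) = 0 := max_eq_left (by simp [ht])
        simpa [this, ht] using hpG t
      · simp only [min_eq_right ht, hpu m le_rfl]
        exact hG.add_smul_sub_mem (hu m) (hu (m + 1))
          ⟨le_max_left _ _, max_le zero_le_one (min_le_right _ _)⟩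
    · rcases hj.lt_or_eq with h | rfl
      · have h' : j ≤ m := Nat.lt_succ_iff.mp h
        have h2 : (j : ℝ) ≤ m := by exact_mod_cast h'
        simp [h2, hpu j h']
      · simp [hpu m le_rfl]

/-- A bounded measurable real function is the almost sure limit of continuous functions, because
these are dense in `L¹` and convergence in `L¹` yields an almost surely convergent subsequence. -/
theorem MeasureTheory.exists_continuous_tendsto_ae {X : Type*} [TopologicalSpace X]
    [TopologicalSpace.PseudoMetrizableSpace X] [MeasurableSpace X] [BorelSpace X]
    (ν : Measure X) [IsFiniteMeasure ν] {f : X → ℝ} (hf : Measurable f) (C : ℝ)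
    (hC : ∀ x, ‖f x‖ ≤ C) :
    ∃ h : ℕ → X → ℝ, (∀ n, Continuous (h n)) ∧
      ∀ᵐ x ∂ν, Tendsto (fun n => h n x) atTop (𝓝 (f x)) := by
  have hmem : MemLp f 1 ν := .of_bound hf.aestronglyMeasurable C (.of_forall hC)
  have hex : ∀ n : ℕ, ∃ g : BoundedContinuousFunction X ℝ,
      eLpNorm (f - (g : X → ℝ)) 1 ν ≤ (n : ℝ≥0∞)⁻¹ ∧ MemLp g 1 ν := fun n =>
    hmem.exists_boundedContinuous_eLpNorm_sub_le (by simp) (by simp)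
  choose g hg hg' using hex
  have hlim : Tendsto (fun n => eLpNorm ((g n : X → ℝ) - f) 1 ν) atTop (𝓝 0) := by
    refine tendsto_of_tendsto_of_tendsto_of_le_of_le tendsto_const_nhds
      ENNReal.tendsto_inv_nat_nhds_zero (fun _ => zero_le) fun n => ?_
    rw [eLpNorm_sub_comm]
    exact hg n
  obtain ⟨ns, -, hns⟩ := (tendstoInMeasure_of_tendsto_eLpNorm one_ne_zero
    (fun n => (hg' n).1) hmem.1 hlim).exists_seq_tendsto_ae
  exact ⟨fun n => g (ns n), fun n => (g (ns n)).continuous, hns⟩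

/-- A simple function with values in a convex set is the almost sure limit of continuous functions
with values in that set: it factors through a bounded integer-valued index, whose continuous
approximations are fed into a path through the values. -/
theorem MeasureTheory.SimpleFunc.exists_continuous_tendsto_ae {X E : Type*} [TopologicalSpace X]
    [TopologicalSpace.PseudoMetrizableSpace X] [MeasurableSpace X] [BorelSpace X]
    (ν : Measure X) [IsFiniteMeasure ν]
    [AddCommGroup E] [Module ℝ E] [TopologicalSpace E] [IsTopologicalAddGroup E]
    [ContinuousSMul ℝ E] {G : Set E} (hG : Convex ℝ G) (g : SimpleFunc X E)
    (hg : ∀ x, g x ∈ G) :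
    ∃ h : ℕ → X → E, (∀ n, Continuous (h n)) ∧ (∀ n x, h n x ∈ G) ∧
      ∀ᵐ x ∂ν, Tendsto (fun n => h n x) atTop (𝓝 (g x)) := by
  rcases isEmpty_or_nonempty X with hX | hX
  · exact ⟨fun _ => g, fun _ => continuous_of_const fun x => (hX.false x).elim, fun _ => hg,
      .of_forall fun _ => tendsto_const_nhds⟩
  obtain ⟨u, hu⟩ := g.finite_range.countable.exists_eq_range (range_nonempty g)
  have hidx : ∀ v, ∃ j, v ∈ range g → u j = v := fun v => by
    by_cases hv : v ∈ range g
    · obtain ⟨j, hj⟩ := hu ▸ hv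
      exact ⟨j, fun _ => hj⟩
    · exact ⟨0, fun h => (hv h).elim⟩
  choose i hi using hidx
  have huG : ∀ j, u j ∈ G := fun j => by
    obtain ⟨x, hx⟩ : u j ∈ range g := hu ▸ Set.mem_range_self j
    exact hx ▸ hg x
  obtain ⟨p, hp, hpG, hpu⟩ := hG.exists_continuous_path u huG (g.range.sup i)
  have hle : ∀ x, i (g x) ≤ g.range.sup i := fun x => Finset.le_sup (g.mem_range_self x)
  obtain ⟨h, hh, hlim⟩ := MeasureTheory.exists_continuous_tendsto_ae ν
    (g.map fun v => (i v : ℝ)).measurable (g.range.sup i : ℕ) fun x => by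
      simpa using hle x
  refine ⟨fun n x => p (h n x), fun n => hp.comp (hh n), fun n x => hpG _, ?_⟩
  filter_upwards [hlim] with x hx
  have hval : p (i (g x)) = g x := by rw [hpu _ (hle x), hi _ (Set.mem_range_self x)]
  have := (hp.tendsto _).comp hx
  rw [SimpleFunc.map_apply, hval] at this
  exact this

/-- A measurable map into a separable metrizable space is the pointwise limit of simple functions
with values in any given set, not necessarily measurable, that contains its range. -/
theorem MeasureTheory.exists_simpleFunc_tendsto_of_mem {X V : Type*} [MeasurableSpace X]
    [Nonempty X] [TopologicalSpace V] [TopologicalSpace.PseudoMetrizableSpace V]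
    [SecondCountableTopology V] [MeasurableSpace V] [BorelSpace V] {K : Set V}
    {f : X → V} (hf : Measurable f) (hfK : ∀ x, f x ∈ K) :
    ∃ g : ℕ → SimpleFunc X V, (∀ n x, g n x ∈ K) ∧
      ∀ x, Tendsto (fun n => g n x) atTop (𝓝 (f x)) := by
  let := TopologicalSpace.pseudoMetrizableSpacePseudoMetric V
  have x₀ : X := Classical.arbitrary X
  exact ⟨fun n => SimpleFunc.approxOn f hf K (f x₀) (hfK x₀) n,
    fun n x => SimpleFunc.approxOn_mem hf (hfK x₀) n x,
    fun x => SimpleFunc.tendsto_approxOn hf (hfK x₀) (subset_closure (hfK x))⟩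

namespace StaticTeam

/-! ### Strategic measures of admissible policies -/

section Model

variable {N : ℕ} {Ω₀ : Type*} {Y U : Fin N → Type*}

/-- The action profile depends on the `k`-th policy only through its value at `yᵏ`. -/
theorem action_update_of_eq {γ : ∀ k, Y k → U k} {k : Fin N} {f g : Y k → U k} {y : ∀ k, Y k}
    (h : f (y k) = g (y k)) :
    action (Function.update γ k f) y = action (Function.update γ k g) y := by
  ext j
  rcases eq_or_ne j k with rfl | hj
  · simpa [action] using h
  · simp [action, hj]

variable [MeasurableSpace Ω₀] [∀ k, MeasurableSpace (Y k)] [∀ k, MeasurableSpace (U k)]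

theorem measurable_action {γ : ∀ k, Y k → U k} (hγ : γ ∈ policies Y U) :
    Measurable (action γ) :=
  measurable_pi_lambda _ fun k => (hγ k).comp (measurable_pi_apply k)

theorem measurable_costIntegrand {c : Ω₀ → (∀ k, Y k) → (∀ k, U k) → ℝ≥0}
    (hc : Measurable fun s : Ω₀ × (∀ k, Y k) × (∀ k, U k) => c s.1 s.2.1 s.2.2)
    {γ : ∀ k, Y k → U k} (hγ : γ ∈ policies Y U) :
    Measurable fun s : Ω₀ × (∀ k, Y k) => (c s.1 s.2 (action γ s.2) : ℝ≥0∞) :=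
  (hc.comp (measurable_fst.prodMk
    (measurable_snd.prodMk ((measurable_action hγ).comp measurable_snd)))).coe_nnreal_ennreal

/-- The image of `μ` under the graph of an admissible policy is a strategic measure of that
policy, and integrating the cost against it gives the expected cost of the policy. -/
theorem exists_isInducedBy (μ : Measure (Ω₀ × (∀ k, Y k))) [IsProbabilityMeasure μ]
    {c : Ω₀ → (∀ k, Y k) → (∀ k, U k) → ℝ≥0}
    (hc : Measurable fun s : Ω₀ × (∀ k, Y k) × (∀ k, U k) => c s.1 s.2.1 s.2.2)
    {γ : ∀ k, Y k → U k} (hγ : γ ∈ policies Y U) :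
    ∃ P, IsInducedBy μ γ P ∧ measureCost c P = cost c μ γ := by
  have hg : Measurable fun s : Ω₀ × (∀ k, Y k) => (s.1, fun k => (s.2 k, γ k (s.2 k))) := by
    refine measurable_fst.prodMk (measurable_pi_lambda _ fun k => ?_)
    have h : Measurable fun s : Ω₀ × (∀ k, Y k) => s.2 k :=
      (measurable_pi_apply k).comp measurable_snd
    exact h.prodMk ((hγ k).comp h)
  have hP : IsProbabilityMeasure (μ.map fun s => (s.1, fun k => (s.2 k, γ k (s.2 k)))) :=
    Measure.isProbabilityMeasure_map hg.aemeasurable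
  refine ⟨⟨_, hP⟩, fun B₀ A B hB₀ hA hB => ?_, ?_⟩
  · have hT : MeasurableSet {s : Ω₀ × (∀ k, Y k) | ∀ k, γ k (s.2 k) ∈ B k} := by
      rw [ofPred_forall]
      exact .iInter fun k => ((hγ k).comp ((measurable_pi_apply k).comp measurable_snd)) (hB k)
    have hS : MeasurableSet (B₀ ×ˢ univ.pi A) := hB₀.prod (.univ_pi hA)
    have hind : (fun s : Ω₀ × (∀ k, Y k) =>
        ∏ k, (B k).indicator (fun _ => (1 : ℝ≥0∞)) (γ k (s.2 k))) =
        {s : Ω₀ × (∀ k, Y k) | ∀ k, γ k (s.2 k) ∈ B k}.indicator 1 := by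
      ext s
      by_cases h : ∀ k, γ k (s.2 k) ∈ B k
      · rw [indicator_of_mem (by exact h)]
        simp [h]
      · rw [indicator_of_notMem (by exact h)]
        obtain ⟨k, hk⟩ := not_forall.mp h
        exact Finset.prod_eq_zero (Finset.mem_univ k) (indicator_of_notMem hk _)
    rw [hind, lintegral_indicator_one hT, Measure.restrict_apply hT]
    change (μ.map _) _ = _
    rw [Measure.map_apply hg (hB₀.prod (.univ_pi fun k => (hA k).prod (hB k)))]
    congr 1
    ext s
    simp only [mem_preimage, mem_prod, mem_univ_pi, mem_inter_iff, mem_ofPred_eq]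
    grind
  · have hm : Measurable fun s : Ω₀ × (∀ k, Y k × U k) =>
        (c s.1 (fun k => (s.2 k).1) (fun k => (s.2 k).2) : ℝ≥0∞) := by
      refine (hc.comp (measurable_fst.prodMk (.prodMk ?_ ?_))).coe_nnreal_ennreal
      · exact measurable_pi_lambda _ fun k =>
          measurable_fst.comp ((measurable_pi_apply k).comp measurable_snd)
      · exact measurable_pi_lambda _ fun k =>
          measurable_snd.comp ((measurable_pi_apply k).comp measurable_snd)
    change ∫⁻ s, _ ∂(μ.map _) = _
    rw [lintegral_map hm hg]
    rfl

theorem update_mem_policies {γ : ∀ k, Y k → U k} (hγ : γ ∈ policies Y U) {k : Fin N}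
    {f : Y k → U k} (hf : Measurable f) : Function.update γ k f ∈ policies Y U := by
  intro j
  rcases eq_or_ne j k with rfl | h
  · simpa using hf
  · simpa [h] using hγ j

/-! ### Dominated convergence of the cost -/

/-- The cost is sequentially continuous along policies with values in a product `∏ Kᵏ` whose
worst-case cost is integrable. -/
theorem tendsto_cost [∀ k, TopologicalSpace (Y k)] [∀ k, TopologicalSpace (U k)]
    {μ : Measure (Ω₀ × (∀ k, Y k))} {c : Ω₀ → (∀ k, Y k) → (∀ k, U k) → ℝ≥0}
    (hc : Measurable fun s : Ω₀ × (∀ k, Y k) × (∀ k, U k) => c s.1 s.2.1 s.2.2)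
    (hc_cont : ∀ ω, Continuous fun p : (∀ k, Y k) × (∀ k, U k) => c ω p.1 p.2)
    {K : ∀ k, Set (U k)} (hK : ∫⁻ s, worstCost c (univ.pi K) s ∂μ < ∞)
    {g : ℕ → ∀ k, Y k → U k} (hg : ∀ n, g n ∈ policies Y U) (hgK : ∀ n k y, g n k y ∈ K k)
    {γ : ∀ k, Y k → U k}
    (hlim : ∀ᵐ s ∂μ, ∀ k, Tendsto (fun n => g n k (s.2 k)) atTop (𝓝 (γ k (s.2 k)))) :
    Tendsto (fun n => cost c μ (g n)) atTop (𝓝 (cost c μ γ)) := by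
  refine tendsto_lintegral_of_dominated_convergence (worstCost c (univ.pi K))
    (fun n => measurable_costIntegrand hc (hg n)) (fun n => .of_forall fun s => ?_) hK.ne ?_
  · exact le_iSup₂ (f := fun u (_ : u ∈ univ.pi K) => (c s.1 s.2 u : ℝ≥0∞))
      (action (g n) s.2) fun k _ => hgK n k _
  · filter_upwards [hlim] with s hs
    refine ENNReal.tendsto_coe.mpr ?_
    exact ((hc_cont s.1).tendsto (s.2, action γ s.2)).comp
      (tendsto_const_nhds.prodMk_nhds (tendsto_pi_nhds.mpr hs))

/-- Constant policies have finite cost, since a point is compact. -/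
theorem optimalCost_lt_top [∀ k, TopologicalSpace (U k)] [∀ k, Nonempty (U k)]
    {μ : Measure (Ω₀ × (∀ k, Y k))} {c : Ω₀ → (∀ k, Y k) → (∀ k, U k) → ℝ≥0}
    (hc_int : ∀ G : ∀ k, Set (U k), (∀ k, IsCompact (G k)) →
      ∫⁻ s, worstCost c (univ.pi G) s ∂μ < ∞) :
    optimalCost c μ < ∞ := by
  let u : ∀ k, U k := fun k => Classical.arbitrary (U k)
  have h : optimalCost c μ ≤ cost c μ fun k _ => u k :=
    iInf₂_le (f := fun γ (_ : γ ∈ policies Y U) => cost c μ γ) (fun k _ => u k)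
      fun k => measurable_const
  refine (h.trans (lintegral_mono fun s => ?_)).trans_lt
    (hc_int (fun k => {u k}) fun k => isCompact_singleton)
  exact le_iSup₂ (f := fun v (_ : v ∈ univ.pi fun k => {u k}) => (c s.1 s.2 v : ℝ≥0∞)) u
    fun k _ => rfl

/-! ### Truncation to compact action sets -/

/-- One component of a policy can be made to take its values in a compact set: where it leaves a
large compact set it is replaced by a constant `u`.  The law of the action is tight, so the
replacement is made on a set of small measure, and there the integral of the (finite) cost of the
policy with the constant `u` is small. -/
theorem exists_update_mem_compact [∀ k, TopologicalSpace (U k)]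
    [∀ k, SecondCountableTopology (U k)]
    [∀ k, TopologicalSpace.IsCompletelyMetrizableSpace (U k)] [∀ k, BorelSpace (U k)]
    {μ : Measure (Ω₀ × (∀ k, Y k))} [IsFiniteMeasure μ]
    {c : Ω₀ → (∀ k, Y k) → (∀ k, U k) → ℝ≥0}
    {γ : ∀ k, Y k → U k} (hγ : γ ∈ policies Y U) {T : ℝ≥0∞} (hT : cost c μ γ < T) (k : Fin N)
    {u : U k} (hu : cost c μ (Function.update γ k fun _ => u) < ∞) :
    ∃ (K : Set (U k)) (f : Y k → U k), IsCompact K ∧ Measurable f ∧ (∀ y, f y ∈ K) ∧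
      cost c μ (Function.update γ k f) < T := by
  obtain ⟨δ, hδ, hδS⟩ := exists_pos_setLIntegral_lt_of_measure_lt hu.ne (tsub_pos_of_lt hT).ne'
  have hmeas : Measurable fun s : Ω₀ × (∀ k, Y k) => γ k (s.2 k) :=
    (hγ k).comp ((measurable_pi_apply k).comp measurable_snd)
  obtain ⟨K, hK, hKδ⟩ :=
    exists_isCompact_closure_measure_compl_lt (μ.map fun s => γ k (s.2 k)) δ hδ
  have hA : MeasurableSet (γ k ⁻¹' closure K) := hγ k isClosed_closure.measurableSet
  let S : Set (Ω₀ × (∀ k, Y k)) := (fun s => γ k (s.2 k)) ⁻¹' closure K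
  have hS : MeasurableSet S := hmeas isClosed_closure.measurableSet
  have hSδ : μ Sᶜ < δ := by
    refine lt_of_le_of_lt ?_ hKδ
    refine (measure_mono ?_).trans (Measure.le_map_apply hmeas.aemeasurable _)
    exact fun s hs hsK => hs (subset_closure hsK)
  classical
  refine ⟨insert u (closure K), (γ k ⁻¹' closure K).piecewise (γ k) fun _ => u, hK.insert u,
    (hγ k).piecewise hA measurable_const, fun y => ?_, ?_⟩
  · by_cases hy : y ∈ γ k ⁻¹' closure K
    · rw [piecewise_eq_of_mem _ _ _ hy]
      exact mem_insert_of_mem _ hy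
    · rw [piecewise_eq_of_notMem _ _ _ hy]
      exact mem_insert _ _
  · calc cost c μ (Function.update γ k _)
        = ∫⁻ s in S, (c s.1 s.2 (action γ s.2) : ℝ≥0∞) ∂μ +
          ∫⁻ s in Sᶜ, (c s.1 s.2 (action (Function.update γ k fun _ => u) s.2) : ℝ≥0∞) ∂μ := by
          rw [cost, ← lintegral_add_compl _ hS]
          congr 1
          · refine setLIntegral_congr_fun hS fun s hs => ?_
            rw [action_update_of_eq (g := γ k) (piecewise_eq_of_mem _ _ _ hs),
              Function.update_eq_self]
          · refine setLIntegral_congr_fun hS.compl fun s hs => ?_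
            rw [action_update_of_eq (g := fun _ => u)
              (piecewise_eq_of_notMem (γ k ⁻¹' closure K) _ _ hs)]
      _ < cost c μ γ + (T - cost c μ γ) :=
          ENNReal.add_lt_add_of_le_of_lt (((setLIntegral_le_lintegral _ _).trans_lt
            (hT.trans_le le_top)).ne) (setLIntegral_le_lintegral _ _) (hδS _ hSδ)
      _ = T := add_tsub_cancel_of_le hT.le

/-- Truncating the components one after the other gives a policy with values in a product of
compact sets whose cost is still below `T`. -/
theorem exists_policy_mem_compact [∀ k, TopologicalSpace (U k)]
    [∀ k, SecondCountableTopology (U k)]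
    [∀ k, TopologicalSpace.IsCompletelyMetrizableSpace (U k)] [∀ k, BorelSpace (U k)]
    {μ : Measure (Ω₀ × (∀ k, Y k))} [IsFiniteMeasure μ]
    {c : Ω₀ → (∀ k, Y k) → (∀ k, U k) → ℝ≥0}
    (hc_const : ∀ γ ∈ policies Y U, cost c μ γ < ∞ →
      ∀ k, ∃ u : U k, cost c μ (Function.update γ k fun _ => u) < ∞)
    {T : ℝ≥0∞} (hT : optimalCost c μ < T) :
    ∃ K : ∀ k, Set (U k), (∀ k, IsCompact (K k)) ∧
      ∃ γ ∈ policies Y U, (∀ k y, γ k y ∈ K k) ∧ cost c μ γ < T := by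
  have key : ∀ S : Finset (Fin N), ∃ γ ∈ policies Y U,
      (∀ k ∈ S, ∃ K, IsCompact K ∧ ∀ y, γ k y ∈ K) ∧ cost c μ γ < T := by
    intro S
    induction S using Finset.induction_on with
    | empty =>
      obtain ⟨γ, hγT⟩ := iInf_lt_iff.mp hT
      obtain ⟨hγ, hγT⟩ := iInf_lt_iff.mp hγT
      exact ⟨γ, hγ, by simp, hγT⟩
    | insert k S _ ih =>
      obtain ⟨γ, hγ, hγS, hγT⟩ := ih
      obtain ⟨u, hu⟩ := hc_const γ hγ (hγT.trans_le le_top) k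
      obtain ⟨K, f, hK, hf, hfK, hfT⟩ := exists_update_mem_compact hγ hγT k hu
      refine ⟨_, update_mem_policies hγ hf, fun j hj => ?_, hfT⟩
      rcases eq_or_ne j k with rfl | hjk
      · exact ⟨K, hK, by simpa using hfK⟩
      · simpa [hjk] using hγS j (Finset.mem_of_mem_insert_of_ne hj hjk)
  obtain ⟨γ, hγ, hγK, hγT⟩ := key Finset.univ
  choose K hK hγK using fun k => hγK k (Finset.mem_univ k)
  exact ⟨K, hK, γ, hγ, hγK, hγT⟩

end Model

/-! ### Continuous near-optimal policies -/

/-- There are continuous policies of nearly optimal cost with values in a product of convex compact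
sets.  These sets are obtained as convex hulls of the finitely many values of a simple policy, so
that their compactness needs no completeness of the ambient space. -/
theorem exists_continuous_policy {N : ℕ} {Ω₀ : Type*} [MeasurableSpace Ω₀]
    {Y : Fin N → Type*} [∀ k, TopologicalSpace (Y k)]
    [∀ k, TopologicalSpace.PseudoMetrizableSpace (Y k)]
    [∀ k, MeasurableSpace (Y k)] [∀ k, BorelSpace (Y k)]
    {E : Fin N → Type*} [∀ k, AddCommGroup (E k)] [∀ k, Module ℝ (E k)]
    [∀ k, TopologicalSpace (E k)] [∀ k, IsTopologicalAddGroup (E k)]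
    [∀ k, ContinuousSMul ℝ (E k)]
    [∀ k, TopologicalSpace.IsCompletelyMetrizableSpace (E k)]
    [∀ k, MeasurableSpace (E k)] [∀ k, BorelSpace (E k)]
    {U : ∀ k, Set (E k)} [∀ k, SecondCountableTopology (U k)]
    (hU_closed : ∀ k, IsClosed (U k)) (hU_convex : ∀ k, Convex ℝ (U k))
    {μ : Measure (Ω₀ × (∀ k, Y k))} [IsProbabilityMeasure μ]
    {c : Ω₀ → (∀ k, Y k) → (∀ k, U k) → ℝ≥0}
    (hc : Measurable fun s : Ω₀ × (∀ k, Y k) × (∀ k, U k) => c s.1 s.2.1 s.2.2)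
    (hc_cont : ∀ ω, Continuous fun p : (∀ k, Y k) × (∀ k, U k) => c ω p.1 p.2)
    (hc_int : ∀ G : ∀ k, Set (U k), (∀ k, IsCompact (G k)) →
      ∫⁻ s, worstCost c (univ.pi G) s ∂μ < ∞)
    (hc_const : ∀ γ ∈ policies Y (fun k => U k), cost c μ γ < ∞ →
      ∀ k, ∃ u : U k, cost c μ (Function.update γ k fun _ => u) < ∞)
    {T : ℝ≥0∞} (hT : optimalCost c μ < T) :
    ∃ G : ∀ k, Set (U k), (∀ k, IsCompact (G k) ∧ Convex ℝ (Subtype.val '' G k)) ∧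
      ∃ γ ∈ continuousPolicies Y (fun k => U k), (∀ k y, γ k y ∈ G k) ∧ cost c μ γ < T := by
  have := fun k => (hU_closed k).isCompletelyMetrizableSpace
  obtain ⟨⟨_, y₀⟩⟩ : Nonempty (Ω₀ × (∀ k, Y k)) := nonempty_of_isProbabilityMeasure μ
  have := fun k => (⟨y₀ k⟩ : Nonempty (Y k))
  obtain ⟨K, hK, γ, hγ, hγK, hγT⟩ := exists_policy_mem_compact hc_const hT
  -- simple policies with values in `∏ Kᵏ` come close to the cost of `γ`
  choose g hgK hg_lim using fun k => exists_simpleFunc_tendsto_of_mem (hγ k) (hγK k)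
  obtain ⟨n, hn⟩ := ((tendsto_cost hc hc_cont (hc_int K hK) (g := fun n k => g k n)
    (fun n k => (g k n).measurable) (fun n k => hgK k n)
    (.of_forall fun s k => hg_lim k (s.2 k))).eventually_lt_const hγT).exists
  -- the hull of the finitely many values of such a policy
  let F : ∀ k, Set (E k) := fun k => convexHull ℝ (range fun y => (g k n y : E k))
  have hF_fin : ∀ k, (range fun y => (g k n y : E k)).Finite := fun k =>
    ((g k n).map Subtype.val).finite_range
  have hFU : ∀ k, F k ⊆ U k := fun k =>
    convexHull_min (range_subset_iff.mpr fun y => (g k n y).2) (hU_convex k)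
  have hF : ∀ k, Convex ℝ (F k) := fun k => convex_convexHull ℝ _
  let G : ∀ k, Set (U k) := fun k => Subtype.val ⁻¹' F k
  have hG : ∀ k, IsCompact (G k) := fun k =>
    (hU_closed k).isClosedEmbedding_subtypeVal.isCompact_preimage ((hF_fin k).isCompact_convexHull ℝ)
  have hGF : ∀ k, Subtype.val '' G k = F k := fun k => by
    rw [Subtype.image_preimage_coe, inter_eq_right.mpr (hFU k)]
  -- continuous policies with values in the hull come close to the cost of the simple policy
  have hmeas : ∀ k, Measurable fun s : Ω₀ × (∀ k, Y k) => s.2 k := fun k =>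
    (measurable_pi_apply k).comp measurable_snd
  have hex := fun k => ((g k n).map Subtype.val).exists_continuous_tendsto_ae
    (μ.map fun s => s.2 k) (hF k) fun y => subset_convexHull ℝ _ ⟨y, rfl⟩
  choose h hh hhF hh_lim using hex
  let γc : ℕ → ∀ k, Y k → U k := fun m k y => ⟨h k m y, hFU k (hhF k m y)⟩
  have hγc : ∀ m k, Continuous (γc m k) := fun m k => (hh k m).subtype_mk _
  have hγc_pol : ∀ m, γc m ∈ policies Y (fun k => U k) := fun m k => (hγc m k).measurable
  obtain ⟨m, hm⟩ := ((tendsto_cost hc hc_cont (hc_int G hG) (γ := fun k => g k n) hγc_pol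
    (fun m k => hhF k m) (by
      rw [ae_all_iff]
      intro k
      filter_upwards [ae_of_ae_map (hmeas k).aemeasurable (hh_lim k)] with s hs
      exact tendsto_subtype_rng.mpr hs)).eventually_lt_const hn).exists
  exact ⟨G, fun k => ⟨hG k, hGF k ▸ hF k⟩, γc m, ⟨hγc_pol m, hγc m⟩, fun k => hhF k m, hm⟩

/-! ### Quantized measurements -/

/-- Along the diagonal `l = n` the quantizers converge pointwise to the identity: a point lies in
`K_n` for all large `n`, and is then moved by less than `1 / n`. -/
theorem QuantizerFamily.tendsto_Q {Y : Type*} [MetricSpace Y] [MeasurableSpace Y]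
    (q : QuantizerFamily Y) (y : Y) : Tendsto (fun n => q.Q n n y) atTop (𝓝 y) := by
  obtain ⟨l, hl, hy⟩ := q.exhausts y
  have hmono : ∀ n, l ≤ n → y ∈ q.K n := fun n hn => by
    induction n, hn using Nat.le_induction with
    | base => exact hy
    | succ n hn ih => exact interior_subset (q.K_subset n (hl.trans hn) ih)
  rw [tendsto_iff_dist_tendsto_zero]
  refine squeeze_zero' (.of_forall fun _ => dist_nonneg) ?_
    (tendsto_one_div_atTop_nhds_zero_nat (𝕜 := ℝ))
  filter_upwards [eventually_ge_atTop l] with n hn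
  have h1 : 1 ≤ n := hl.trans hn
  obtain ⟨z, hz, hyz⟩ := q.isNet n n h1 h1 y (hmono n hn)
  rw [dist_comm]
  exact (q.Q_nearest n n h1 h1 y (hmono n hn) z hz).trans hyz.le

end StaticTeam

theorem mainTheorem6 {N : ℕ}
    -- the exogenous variable, with its Borel σ-algebra
    {Ω₀ : Type*} [TopologicalSpace Ω₀] [MeasurableSpace Ω₀] [BorelSpace Ω₀]
    -- measurement spaces: locally compact separable metric spaces
    {Y : Fin N → Type*} [∀ k, MetricSpace (Y k)] [∀ k, SecondCountableTopology (Y k)]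
    [∀ k, LocallyCompactSpace (Y k)] [∀ k, MeasurableSpace (Y k)] [∀ k, BorelSpace (Y k)]
    -- action spaces: separable closed convex subsets of completely metrizable locally convex spaces
    {E : Fin N → Type*} [∀ k, AddCommGroup (E k)] [∀ k, Module ℝ (E k)]
    [∀ k, TopologicalSpace (E k)] [∀ k, IsTopologicalAddGroup (E k)]
    [∀ k, ContinuousSMul ℝ (E k)] [∀ k, LocallyConvexSpace ℝ (E k)]
    [∀ k, TopologicalSpace.IsCompletelyMetrizableSpace (E k)]
    [∀ k, MeasurableSpace (E k)] [∀ k, BorelSpace (E k)]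
    (U : ∀ k, Set (E k)) [∀ k, SecondCountableTopology (U k)]
    (hU_ne : ∀ k, (U k).Nonempty) (hU_closed : ∀ k, IsClosed (U k))
    (hU_convex : ∀ k, Convex ℝ (U k))
    -- the joint law of `(ω₀, y)`
    (μ : Measure (Ω₀ × (∀ k, Y k))) [IsProbabilityMeasure μ]
    -- the cost function
    (c : Ω₀ → (∀ k, Y k) → (∀ k, U k) → ℝ≥0)
    (hc_meas : Measurable fun s : Ω₀ × (∀ k, Y k) × (∀ k, U k) => c s.1 s.2.1 s.2.2)
    (hc_cont : ∀ ω, Continuous fun p : (∀ k, Y k) × (∀ k, U k) => c ω p.1 p.2)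
    (hc_bdd : ∀ C : Set (Ω₀ × (∀ k, Y k) × (∀ k, U k)), IsCompact C →
      BddAbove ((fun s => c s.1 s.2.1 s.2.2) '' C))
    -- `w_G` is integrable for every compact product set `G`
    (hc_int : ∀ G : ∀ k, Set (U k), (∀ k, IsCompact (G k)) →
      ∫⁻ s, StaticTeam.worstCost c (univ.pi G) s ∂μ < ∞)
    -- replacing one policy by a suitable constant keeps the cost finite
    (hc_const : ∀ γ ∈ StaticTeam.policies Y (fun k => U k), StaticTeam.cost c μ γ < ∞ →
      ∀ k, ∃ u : U k, StaticTeam.cost c μ (Function.update γ k fun _ => u) < ∞)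
    -- the measurement quantizers
    (q : ∀ k, StaticTeam.QuantizerFamily (Y k)) :
    (∀ ε : ℝ, 0 < ε → ∃ G : ∀ k, Set (U k),
      (∀ k, IsCompact (G k) ∧ Convex ℝ (Subtype.val '' G k)) ∧
      (⨅ P ∈ StaticTeam.strategicMeasures μ
          (StaticTeam.continuousPolicies Y (fun k => U k) ∩
            StaticTeam.policiesInto Y (univ.pi G)),
        StaticTeam.measureCost c P) < StaticTeam.optimalCost c μ + ENNReal.ofReal ε) ∧
    (∀ ε : ℝ, 0 < ε → ∃ l n : ℕ, 1 ≤ l ∧ 1 ≤ n ∧ ∃ G : ∀ k, Set (U k),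
      (∀ k, IsCompact (G k) ∧ Convex ℝ (Subtype.val '' G k)) ∧
      ∃ P ∈ StaticTeam.strategicMeasures μ
            (StaticTeam.policiesThrough (fun k => U k) fun k => (q k).Q l n) ∩
          StaticTeam.strategicMeasures μ (StaticTeam.policiesInto Y (univ.pi G)),
        StaticTeam.measureCost c P < StaticTeam.optimalCost c μ + ENNReal.ofReal ε) := by
  have := fun k => (hU_ne k).to_subtype
  have hlt : ∀ ε : ℝ, 0 < ε →
      StaticTeam.optimalCost c μ < StaticTeam.optimalCost c μ + ENNReal.ofReal ε := fun ε hε =>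
    ENNReal.lt_add_right (StaticTeam.optimalCost_lt_top hc_int).ne (by simpa using hε)
  refine ⟨fun ε hε => ?_, fun ε hε => ?_⟩
  · obtain ⟨G, hG, γ, hγ, hγG, hγT⟩ := StaticTeam.exists_continuous_policy hU_closed hU_convex
      hc_meas hc_cont hc_int hc_const (hlt ε hε)
    obtain ⟨P, hP, hPc⟩ := StaticTeam.exists_isInducedBy μ hc_meas hγ.1
    exact ⟨G, hG, (iInf₂_le P ⟨γ, ⟨hγ, hγ.1, fun y k _ => hγG k (y k)⟩, hP⟩).trans_lt
      (hPc.trans_lt hγT)⟩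
  · obtain ⟨G, hG, γ, hγ, hγG, hγT⟩ := StaticTeam.exists_continuous_policy hU_closed hU_convex
      hc_meas hc_cont hc_int hc_const (hlt ε hε)
    -- indices shifted by one, since the quantizers carry no information at index `0`
    have hpol : ∀ n : ℕ, (fun k => γ k ∘ (q k).Q (n + 1) (n + 1)) ∈
        StaticTeam.policies Y (fun k => U k) := fun n k =>
      (hγ.1 k).comp ((q k).measurable_Q _ _ (by omega) (by omega))
    obtain ⟨n, hn⟩ := ((StaticTeam.tendsto_cost hc_meas hc_cont (hc_int G fun k => (hG k).1)
      hpol (fun n k y => hγG k _) (.of_forall fun s k =>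
        (((hγ.2 k).tendsto _).comp (((q k).tendsto_Q (s.2 k)).comp
          (tendsto_add_atTop_nat 1))))).eventually_lt_const hγT).exists
    obtain ⟨P, hP, hPc⟩ := StaticTeam.exists_isInducedBy μ hc_meas (hpol n)
    exact ⟨n + 1, n + 1, by omega, by omega, G, hG, P,
      ⟨⟨_, ⟨hpol n, γ, hγ.1, fun k => rfl⟩, hP⟩,
        ⟨_, ⟨hpol n, fun y k _ => hγG k _⟩, hP⟩⟩, hPc.trans_lt hn⟩
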